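/- All graphs are finite and simple, and graphs are counted up to isomorphism. For an integer $k\ge 0$, a graph $G$ is $k$-vertex-critical if $\chi(G)=k$ and $\chi(G-v)<k$ for every vertex $v\in V(G)$. A graph is $(H_1,H_2)$-free if it has no induced subgraph isomorphic to $H_1$ or to $H_2$. Let $P_n$ and $K_n$ denote the path and the complete graph on $n$ vertices, let $+$ denote disjoint union, and let the co-gem be the graph $P_4+P_1$. Corollary 4.2. For every $k$ there are, up to isomorphism, only finitely many $k$-vertex-critical $(\text{co-gem},K_3+P_1)$-free graphs. -/

import Mathlib

open SimpleGraph

/-- `G` is `k`-vertex-critical: `χ(G) = k`, and `χ(G - v) < k` for every vertex `v`, where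
`G - v` is the subgraph induced by the vertices other than `v`. -/
def IsVertexCritical {V : Type*} (k : ℕ) (G : SimpleGraph V) : Prop :=
  G.chromaticNumber = k ∧ ∀ v : V, (G.induce {w | w ≠ v}).chromaticNumber < k

/-- `G` is `H`-free: no induced subgraph of `G` is isomorphic to `H`. -/
def IsInducedFree {U V : Type*} (H : SimpleGraph U) (G : SimpleGraph V) : Prop :=
  ¬ H.IsIndContained G

/-- The co-gem `P₄ + P₁` (disjoint union). -/
abbrev coGem : SimpleGraph (Fin 4 ⊕ Fin 1) := pathGraph 4 ⊕g pathGraph 1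

/-- The graph `K₃ + P₁` (disjoint union). -/
abbrev triangleAddP1 : SimpleGraph (Fin 3 ⊕ Fin 1) := completeGraph (Fin 3) ⊕g pathGraph 1

/-! The order is at most `k * k`: a `k`-colouring has `k` classes, and every independent set has at
most `k` vertices. Criticality enters mainly because an endomorphism missing a vertex `v` would
colour `G` with the fewer than `k` colours of `G - v`. So neither a vertex nor an edge can be folded
onto another. This excludes an induced `K₂ + 2P₁`: one of its isolated vertices would lie on an edge
that folds onto the `K₂`. A larger independent set would then let a colouring of `G - v` extend to
`v`. -/

section Patterns

variable {V : Type*} {G : SimpleGraph V}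

/-- In a co-gem-free graph, the non-neighbours of a vertex induce no `P₄`. -/
theorem IsInducedFree.not_pathGraph_four_add (h : IsInducedFree coGem G) {a p q r s : V}
    (hpq : G.Adj p q) (hqr : G.Adj q r) (hrs : G.Adj r s)
    (hpr : ¬ G.Adj p r) (hps : ¬ G.Adj p s) (hqs : ¬ G.Adj q s)
    (hp : ¬ G.Adj p a) (hq : ¬ G.Adj q a) (hr : ¬ G.Adj r a) (hs : ¬ G.Adj s a) : False := by
  have adj : ∀ x y, G.Adj (Sum.elim ![p, q, r, s] ![a] x) (Sum.elim ![p, q, r, s] ![a] y) ↔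
      coGem.Adj x y := by
    rintro (x | x) (y | y) <;> fin_cases x <;> fin_cases y <;>
      simp [pathGraph_adj, *, G.adj_comm] <;> simp_all [G.adj_comm]
  refine h ⟨⟨⟨Sum.elim ![p, q, r, s] ![a], ?_⟩, adj _ _⟩⟩
  have h1 : p ≠ r := by rintro rfl; exact hps hrs
  have h2 : p ≠ s := by rintro rfl; exact hqs hpq.symm
  have h3 : q ≠ s := by rintro rfl; exact hps hpq
  have h4 : a ≠ p := by rintro rfl; exact hq hpq.symm
  have h5 : a ≠ q := by rintro rfl; exact hp hpq
  have h6 : a ≠ r := by rintro rfl; exact hq hqr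
  have h7 : a ≠ s := by rintro rfl; exact hr hrs
  have h8 := hpq.ne
  have h9 := hqr.ne
  have h10 := hrs.ne
  rintro (x | x) (y | y) <;> fin_cases x <;> fin_cases y <;>
    simp_all [eq_comm]

/-- In a `K₃ + P₁`-free graph, the non-neighbours of a vertex induce no triangle. -/
theorem IsInducedFree.not_triangle_add (h : IsInducedFree triangleAddP1 G) {a p q r : V}
    (hpq : G.Adj p q) (hqr : G.Adj q r) (hpr : G.Adj p r)
    (hp : ¬ G.Adj p a) (hq : ¬ G.Adj q a) (hr : ¬ G.Adj r a) : False := by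
  have adj : ∀ x y, G.Adj (Sum.elim ![p, q, r] ![a] x) (Sum.elim ![p, q, r] ![a] y) ↔
      triangleAddP1.Adj x y := by
    rintro (x | x) (y | y) <;> fin_cases x <;> fin_cases y <;>
      simp [*, G.adj_comm] <;> simp_all [G.adj_comm]
  refine h ⟨⟨⟨Sum.elim ![p, q, r] ![a], ?_⟩, adj _ _⟩⟩
  have h4 : a ≠ p := by rintro rfl; exact hq hpq.symm
  have h5 : a ≠ q := by rintro rfl; exact hp hpq
  have h6 : a ≠ r := by rintro rfl; exact hq hqr
  have h8 := hpq.ne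
  have h9 := hqr.ne
  have h10 := hpr.ne
  rintro (x | x) (y | y) <;> fin_cases x <;> fin_cases y <;>
    simp_all [eq_comm]

end Patterns

namespace IsVertexCritical

variable {V : Type*} {G : SimpleGraph V} {k : ℕ}

theorem not_colorable (h : IsVertexCritical k G) {m : ℕ} (hm : m < k) : ¬ G.Colorable m := by
  intro hc
  have := hc.chromaticNumber_le
  rw [h.1] at this
  exact absurd (Nat.cast_le.mp this) (by lia)

theorem exists_colorable_induce (h : IsVertexCritical k G) (v : V) :
    ∃ m < k, (G.induce {w | w ≠ v}).Colorable m := by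
  have hv := h.2 v
  obtain ⟨m, hm⟩ := ENat.ne_top_iff_exists.mp (ne_top_of_lt hv)
  refine ⟨m, ?_, chromaticNumber_le_iff_colorable.mp hm.symm.le⟩
  rw [← hm] at hv
  exact_mod_cast hv

/-- Every endomorphism of a vertex-critical graph is surjective. -/
theorem surjective_hom (h : IsVertexCritical k G) (f : G →g G) : Function.Surjective f := by
  intro v
  by_contra! hv
  obtain ⟨m, hm, hc⟩ := h.exists_colorable_induce v
  let g : G →g G.induce {w | w ≠ v} := ⟨fun x => ⟨f x, hv x⟩, fun hxy => f.map_adj hxy⟩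
  exact h.not_colorable hm (hc.of_hom g)

/-- A vertex-critical graph has no two distinct vertices with nested neighbourhoods. -/
theorem not_neighborSet_subset (h : IsVertexCritical k G) {x y : V} (hxy : x ≠ y)
    (hN : ∀ z, G.Adj x z → G.Adj y z) : False := by
  classical
  have hx : ¬ G.Adj x y := fun e => G.loopless.irrefl _ (hN y e)
  obtain ⟨w, hw⟩ := h.surjective_hom ⟨fun w => if w = x then y else w, by
    intro a b hab
    split_ifs with ha hb hb
    · subst ha hb; exact (G.loopless.irrefl _ hab).elim
    · subst ha; exact hN _ hab
    · subst hb; exact (hN _ hab.symm).symm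
    · exact hab⟩ x
  change (if w = x then y else w) = x at hw
  split_ifs at hw with e
  · exact hxy hw.symm
  · exact e hw

/-- The analogue of `not_neighborSet_subset` for two disjoint edges. -/
theorem not_edge_neighborSet_subset (h : IsVertexCritical k G) {x₁ y₁ x₂ y₂ : V}
    (h₂ : G.Adj x₂ y₂) (hxx : x₁ ≠ x₂) (hxy : x₁ ≠ y₂)
    (hx : ∀ z, G.Adj x₁ z → z ≠ y₁ → G.Adj x₂ z)
    (hy : ∀ z, G.Adj y₁ z → z ≠ x₁ → G.Adj y₂ z) : False := by
  classical
  -- Folding `x₁y₁` onto `x₂y₂` is an endomorphism that misses `x₁`.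
  obtain ⟨w, hw⟩ := h.surjective_hom
    ⟨fun w => if w = x₁ then x₂ else if w = y₁ then y₂ else w, by
      intro a b hab
      have := hab.ne
      have := h₂.symm
      have := hab.symm
      split_ifs <;> subst_vars <;> first | assumption | contradiction | skip
      · exact hx _ hab ‹_›
      · exact hy _ hab ‹_›
      · exact (hx _ hab.symm ‹_›).symm
      · exact (hy _ hab.symm ‹_›).symm⟩ x₁
  change (if w = x₁ then x₂ else if w = y₁ then y₂ else w) = x₁ at hw
  split_ifs at hw with e e'
  · exact hxx hw.symm
  · exact hxy hw.symm
  · exact e hw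

end IsVertexCritical

section Structure

variable {V : Type*} {G : SimpleGraph V} {k : ℕ}

/-- If `p` is a non-neighbour of `a` and `rs` is an edge anticomplete to `{a, p}`, then every common
neighbour of `a` and `r` is adjacent to `p`. -/
theorem adj_of_edge_anticomplete (hc : IsInducedFree coGem G)
    (ht : IsInducedFree triangleAddP1 G) {a p r s u : V} (hrs : G.Adj r s)
    (hpa : ¬ G.Adj p a) (hra : ¬ G.Adj r a) (hsa : ¬ G.Adj s a)
    (hrp : ¬ G.Adj r p) (hsp : ¬ G.Adj s p) (hua : G.Adj u a) (hur : G.Adj u r) :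
    G.Adj u p := by
  by_contra hup
  by_cases hus : G.Adj u s
  · exact ht.not_triangle_add hur hrs hus hup hrp hsp
  · exact hc.not_pathGraph_four_add hua.symm hur hrs (fun e => hra e.symm) (fun e => hsa e.symm)
      hus (fun e => hpa e.symm) hup hrp hsp

/-- If `x₁y₁` and `x₂y₂` induce `2K₂` among the non-neighbours of `a`, then every neighbour of `x₁`
other than `y₁` is a neighbour of `x₂`. -/
theorem neighborSet_subset_of_two_edges (h : IsVertexCritical k G) (hc : IsInducedFree coGem G)
    (ht : IsInducedFree triangleAddP1 G) {a x₁ y₁ x₂ y₂ : V}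
    (h₁ : G.Adj x₁ y₁) (h₂ : G.Adj x₂ y₂)
    (hx₁ : ¬ G.Adj x₁ a) (hy₁ : ¬ G.Adj y₁ a) (hx₂ : ¬ G.Adj x₂ a) (hy₂ : ¬ G.Adj y₂ a)
    (hxx : ¬ G.Adj x₁ x₂) (hxy : ¬ G.Adj x₁ y₂) (hyx : ¬ G.Adj y₁ x₂) (hyy : ¬ G.Adj y₁ y₂)
    (z : V) (hz : G.Adj x₁ z) (hzy : z ≠ y₁) : G.Adj x₂ z := by
  by_cases hza : G.Adj z a
  · exact (adj_of_edge_anticomplete hc ht h₁ hx₂ hx₁ hy₁ hxx hyx hza hz.symm).symm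
  have hzy₁ : ¬ G.Adj z y₁ := fun e => ht.not_triangle_add hz e h₁ hx₁ hza hy₁
  have hzx₂ : ¬ G.Adj z x₂ := by
    intro e
    by_cases e' : G.Adj z y₂
    · exact ht.not_triangle_add e h₂ e' hza hx₂ hy₂
    · exact hc.not_pathGraph_four_add hz e h₂ hxx hxy e' hx₁ hza hx₂ hy₂
  -- No such `z` exists: its neighbourhood would lie inside that of `y₁`. A neighbour `t` of `z`
  -- that sees `a` is forced to see `x₂`, and then `y₁`.
  refine (h.not_neighborSet_subset hzy fun t hzt => ?_).elim
  by_cases hta : G.Adj t a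
  · have := adj_of_edge_anticomplete hc ht hz.symm hx₂ hza hx₁ hzx₂ hxx hta hzt.symm
    exact (adj_of_edge_anticomplete hc ht h₂ hy₁ hx₂ hy₂ (fun e => hyx e.symm)
      (fun e => hyy e.symm) hta this).symm
  · by_contra hty
    by_cases htx : G.Adj t x₁
    · exact ht.not_triangle_add hzt htx hz.symm hza hta hx₁
    · exact hc.not_pathGraph_four_add hzt.symm hz.symm h₁ htx (fun e => hty e.symm) hzy₁
        hta hza hx₁ hy₁

/-- A vertex-critical (co-gem, `K₃ + P₁`)-free graph has no induced `K₂ + 2P₁`. -/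
theorem not_edge_add_two_vertices (h : IsVertexCritical k G) (hc : IsInducedFree coGem G)
    (ht : IsInducedFree triangleAddP1 G) {a b v w : V} (hab : a ≠ b) (hba : ¬ G.Adj b a)
    (hvw : G.Adj v w) (hva : ¬ G.Adj v a) (hwa : ¬ G.Adj w a) (hvb : ¬ G.Adj v b)
    (hwb : ¬ G.Adj w b) : False := by
  refine h.not_neighborSet_subset hab.symm fun d hbd => ?_
  by_contra had
  have hda : ¬ G.Adj d a := fun e => had e.symm
  -- Stated for any such edge, so that it also applies to `vw` reversed: `bd` and `vw` then induce
  -- `2K₂` among the non-neighbours of `a`.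
  have key : ∀ {v w : V}, G.Adj v w → ¬ G.Adj v a → ¬ G.Adj w a → ¬ G.Adj v b → ¬ G.Adj w b →
      ¬ G.Adj d v := by
    intro v w hvw hva hwa hvb hwb e
    by_cases e' : G.Adj d w
    · exact ht.not_triangle_add e hvw e' hda hva hwa
    · exact hc.not_pathGraph_four_add hbd e hvw (fun e => hvb e.symm) (fun e => hwb e.symm) e'
        hba hda hva hwa
  have hdv := key hvw hva hwa hvb hwb
  have hdw := key hvw.symm hwa hva hwb hvb
  have hbv : ¬ G.Adj b v := fun e => hvb e.symm
  have hbw : ¬ G.Adj b w := fun e => hwb e.symm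
  refine h.not_edge_neighborSet_subset (x₁ := b) (y₁ := d) hvw ?_ ?_
    (neighborSet_subset_of_two_edges h hc ht hbd hvw hba hda hva hwa hbv hbw hdv hdw)
    (neighborSet_subset_of_two_edges h hc ht hbd.symm hvw.symm hda hba hwa hva hdw hdv hbw hbv)
  · rintro rfl; exact hdv hbd.symm
  · rintro rfl; exact hdw hbd.symm

/-- Independent sets in a `k`-vertex-critical (co-gem, `K₃ + P₁`)-free graph have at most `k`
vertices. -/
theorem card_le_of_isIndepSet (h : IsVertexCritical k G) (hc : IsInducedFree coGem G)
    (ht : IsInducedFree triangleAddP1 G) (I : Finset V) (hI : G.IsIndepSet (I : Set V)) :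
    I.card ≤ k := by
  classical
  by_contra! hlt
  obtain ⟨v, hv⟩ : I.Nonempty := Finset.card_pos.mp (by lia)
  obtain ⟨m, hm, ⟨C⟩⟩ := h.exists_colorable_induce v
  let c : V → ℕ := fun x => if hx : x ≠ v then (C ⟨x, hx⟩ : ℕ) else 0
  have hcm : ∀ x, x ≠ v → c x < m := fun x hx => by simp [c, hx]
  have hcadj : ∀ x y, x ≠ v → y ≠ v → G.Adj x y → c x ≠ c y := by
    intro x y hx hy hxy e
    simp only [c, hx, hy, dite_true, ne_eq, not_false_eq_true] at e
    exact C.valid (v := ⟨x, hx⟩) (w := ⟨y, hy⟩) hxy (Fin.ext e)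
  -- Without `v`, at least `k > m` vertices of `I` remain, so two share a colour.
  obtain ⟨a, ha, b, hb, hab, hcab⟩ := Finset.exists_ne_map_eq_of_card_lt_of_maps_to
    (s := I.erase v) (t := Finset.range m) (f := c)
    (by rw [Finset.card_erase_of_mem hv, Finset.card_range]; lia)
    (fun x hx => by simpa using hcm x (Finset.ne_of_mem_erase hx))
  obtain ⟨hav, ha⟩ := Finset.mem_erase.mp ha
  obtain ⟨hbv, hb⟩ := Finset.mem_erase.mp hb
  -- A neighbour `w` of `v` with this colour would miss `a` and `b`, so `vw`, `a`, `b` would induce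
  -- `K₂ + 2P₁`. Hence `v` can take the colour of `a`.
  have key : ∀ w, w ≠ v → G.Adj v w → c w ≠ c a := by
    intro w hw hvw e
    refine not_edge_add_two_vertices h hc ht hab (hI hb ha hab.symm) hvw (hI hv ha hav.symm) ?_
      (hI hv hb hbv.symm) ?_
    · exact fun e' => hcadj _ _ hw hav e' e
    · exact fun e' => hcadj _ _ hw hbv e' (e.trans hcab)
  let c' : V → ℕ := fun x => if x = v then c a else c x
  have hc'm : ∀ x, c' x < m := by
    intro x
    by_cases hx : x = v
    · simpa [c', hx] using hcm a hav
    · simpa [c', hx] using hcm x hx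
  refine h.not_colorable hm ⟨Coloring.mk (fun x => (⟨c' x, hc'm x⟩ : Fin m)) ?_⟩
  intro x y hxy e
  have e : c' x = c' y := congrArg Fin.val e
  simp only [c'] at e
  split_ifs at e with hx hy hy
  · exact hxy.ne (hx.trans hy.symm)
  · exact key y hy (hx ▸ hxy) e.symm
  · exact key x hx (hy ▸ hxy.symm) e
  · exact hcadj x y hx hy hxy e

theorem card_le_mul_self [Fintype V] (h : IsVertexCritical k G) (hc : IsInducedFree coGem G)
    (ht : IsInducedFree triangleAddP1 G) : Fintype.card V ≤ k * k := by
  classical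
  obtain ⟨C⟩ : G.Colorable k := chromaticNumber_le_iff_colorable.mp h.1.le
  have := Finset.card_le_mul_card_image_of_maps_to (s := (Finset.univ : Finset V))
    (t := (Finset.univ : Finset (Fin k))) (f := C) (fun _ _ => Finset.mem_univ _) k (by
      intro i _
      refine card_le_of_isIndepSet h hc ht _ ?_
      intro x hx y hy _ hxy
      simp only [Finset.coe_filter, Finset.mem_univ, true_and, Set.mem_ofPred_eq] at hx hy
      exact C.valid hxy (hx.trans hy.symm))
  simpa using this

end Structure

/-- Up to isomorphism there are finitely many: some finite set `S` of graphs contains an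
isomorphic copy of every such finite graph. -/
theorem corollary4p2 (k : ℕ) :
    ∃ S : Set (Σ n : ℕ, SimpleGraph (Fin n)), S.Finite ∧
      ∀ (V : Type*) [Finite V] (G : SimpleGraph V),
        IsVertexCritical k G → IsInducedFree coGem G → IsInducedFree triangleAddP1 G →
          ∃ F ∈ S, Nonempty (G ≃g F.2) := by
  refine ⟨⋃ n ∈ Set.Iic (k * k), Set.range (Sigma.mk n), ?_, ?_⟩
  · exact (Set.finite_Iic (k * k)).biUnion fun _ _ => Set.finite_range _
  · intro V _ G h hc ht
    have := Fintype.ofFinite V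
    exact ⟨⟨Fintype.card V, G.map (Fintype.equivFin V).toEmbedding⟩,
      Set.mem_biUnion (card_le_mul_self h hc ht) (Set.mem_range_self _), ⟨Iso.map (Fintype.equivFin V) G⟩⟩
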